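/- **Theorem (Individual regret for OptOPPM).** Let $\mathscr X,\mathscr Y$ be real normed spaces and let $X\subset\mathscr X$, $Y\subset\mathscr Y$ be compact convex sets with diameters $D_X,D_Y$. For a proper function $\varphi$ with values in $(-\infty,+\infty]$ let $\varphi^\star(z)=\sup_x\langle z,x\rangle-\varphi(x)$ and let $B_\varphi(x,z)=\varphi(x)+\varphi^\star(z)-\langle z,x\rangle$ be its Fenchel coupling. Let the regularizers $\phi$ on $\mathscr X$ and $\psi$ on $\mathscr Y$ be proper and $1$-strongly convex, i.e. $B_\phi(x,z)\ge\frac12\|x-y\|^2$ for all $x,y\in\mathscr X$ and $z\in\partial\phi(y)$, and let $B_\phi(\cdot,z)$ be $L_\phi$-Lipschitz on $X$ for all $z\in\partial\phi(\alpha)$, $\alpha\in X$; similarly for $\psi$ on $Y$ with constant $L_\psi$. Let the payoffs $f_t$ and the predictors $h_t$ ($1\le t\le T$) be convex-concave on $X\times Y$, with subgradients $\partial_x f_t,\partial_x h_t$ bounded in norm by $G_X$ and $\partial_y(-f_t),\partial_y(-h_t)$ bounded in norm by $G_Y$ on $X\times Y$. Starting from $\widetilde x_1\in X$, $\widetilde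 y_1\in Y$ and $\widetilde x_1^\phi\in\partial\phi(\widetilde x_1)$, $\widetilde y_1^\psi\in\partial\psi(\widetilde y_1)$, OptOPPM computes, for $t=1,\dots,T$, a saddle point and two optimizers $$(x_t,y_t)=\arg\min_{x\in X}\max_{y\in Y}\ h_t(x,y)+\tfrac1{\eta_t}B_\phi(x,\widetilde x_t^\phi)-\tfrac1{\gamma_t}B_\psi(y,\widetilde y_t^\psi),$$ $$\widetilde x_{t+1}=\arg\min_{x\in X}\eta_tf_t(x,y_t)+B_\phi(x,\widetilde x_t^\phi),\qquad \widetilde y_{t+1}=\arg\max_{y\in Y}\gamma_tf_t(x_t,y)-B_\psi(y,\widetilde y_t^\psi).$$ Here $x_t^\phi\in\partial\phi(x_t)$, $\widetilde x_{t+1}^\phi\in\partial\phi(\widetilde x_{t+1})$, $y_t^\psi\in\partial\psi(y_t)$, $\widetilde y_{t+1}^\psi\in\partial\psi(\widetilde y_{t+1})$ are the subgradients of the regularizers at the computed points; at a point where the regularizer is not differentiable along the feasible set, the subgradient is one for which the first-order optimality condition of the step that produced the point holds: $x_t$ minimizes $\eta_th_t(\cdot,y_t)+\langle x_t^\phi-\widetilde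 x_t^\phi,\cdot\rangle$ over $X$, $\widetilde x_{t+1}$ minimizes $\eta_tf_t(\cdot,y_t)+\langle \widetilde x_{t+1}^\phi-\widetilde x_t^\phi,\cdot\rangle$ over $X$, and similarly $y_t$ and $\widetilde y_{t+1}$ minimize $-\gamma_th_t(x_t,\cdot)+\langle y_t^\psi-\widetilde y_t^\psi,\cdot\rangle$ and $-\gamma_tf_t(x_t,\cdot)+\langle\widetilde y_{t+1}^\psi-\widetilde y_t^\psi,\cdot\rangle$ over $Y$. Let $x'_t\in\arg\min_{x\in X}f_t(x,y_t)$ and $y'_t\in\arg\max_{y\in Y}f_t(x_t,y)$ for $1\le t\le T$, let $x'_0\in X$, $y'_0\in Y$ be arbitrary, and let $C^1,C^2$ be upper bounds for $C^1_T=\sum_{t=1}^T\|x'_t-x'_{t-1}\|$ and $C^2_T=\sum_{t=1}^T\|y'_t-y'_{t-1}\|$. Let $\epsilon>0$ and let the learning rates be $$\eta_t=\frac{L_\phi(D_X+C^1)}{\epsilon+\sum_{\tau=1}^{t-1}\delta^1_\tau},\qquad \gamma_t=\frac{L_\psi(D_Y+C^2)}{\epsilon+\sum_{\tau=1}^{t-1}\delta^2_\tau},$$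 $$\delta_t^1=f_t(x_t,y_t)-h_t(x_t,y_t)+h_t(\widetilde x_{t+1},y_t)-f_t(\widetilde x_{t+1},y_t)-B_\phi(\widetilde x_{t+1},x_t^\phi)/\eta_t,$$ $$\delta_t^2=f_t(x_t,\widetilde y_{t+1})-h_t(x_t,\widetilde y_{t+1})+h_t(x_t,y_t)-f_t(x_t,y_t)-B_\psi(\widetilde y_{t+1},y_t^\psi)/\gamma_t.$$ Then $\delta_t^1,\delta_t^2\ge0$ for all $1\le t\le T$, and the individual regrets $$\mathrm{Reg}^1_T=\sum_{t=1}^T\bigl(f_t(x_t,y_t)-f_t(x'_t,y_t)\bigr),\qquad \mathrm{Reg}^2_T=\sum_{t=1}^T\bigl(f_t(x_t,y'_t)-f_t(x_t,y_t)\bigr)$$ satisfy $$\mathrm{Reg}^i_T\le\epsilon+K\min\Bigl\{\sum_{t=1}^T\rho(f_t,h_t),\ \sqrt{(1+C^i)T}\Bigr\},\qquad i=1,2,$$ where $\rho(f,h)=\max_{x\in X,\,y\in Y}|f(x,y)-h(x,y)|$ and the constant $K$ depends only on $D_X,D_Y,G_X,G_Y,L_\phi,L_\psi$. That is, $\mathrm{Reg}^i_T\le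 O\bigl(\min\{\sum_{t}\rho(f_t,h_t),\sqrt{(1+C^i)T}\}\bigr)$ up to the fixed additive constant $\epsilon$. -/

import Mathlib

noncomputable section

namespace OSP

/-! Convex-analytic notions for extended-real-valued functions on a real normed space. -/

section Convex

variable {E : Type*} [NormedAddCommGroup E] [NormedSpace ℝ E]

/-- A proper function: never `-∞`, and finite somewhere. -/
def IsProper (φ : E → EReal) : Prop :=
  (∀ x, φ x ≠ ⊥) ∧ ∃ x, φ x ≠ ⊤

/-- The subdifferential of `φ` at `u`, a set of continuous linear functionals. -/
def subdiff (φ : E → EReal) (u : E) : Set (StrongDual ℝ E) :=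
  {z | ∀ x, φ u + ((z (x - u) : ℝ) : EReal) ≤ φ x}

/-- The convex conjugate `φ⋆(z) = sup_x ⟨z, x⟩ - φ(x)`. -/
def conjugate (φ : E → EReal) (z : StrongDual ℝ E) : EReal :=
  ⨆ x, ((z x : ℝ) : EReal) - φ x

/-- The Fenchel coupling `B_φ(x, z) = φ(x) + φ⋆(z) - ⟨z, x⟩`. -/
def fenchelCoupling (φ : E → EReal) (x : E) (z : StrongDual ℝ E) : EReal :=
  φ x + conjugate φ z - ((z x : ℝ) : EReal)

/-- The value of the Fenchel coupling as a real number. It is only used at points where the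
coupling is finite (see `IsRegularizer.lipschitz`). -/
def coupling (φ : E → EReal) (x : E) (z : StrongDual ℝ E) : ℝ :=
  (fenchelCoupling φ x z).toReal

/-- `φ` is `μ`-strongly convex: `B_φ(x, z) ≥ (μ/2) ‖x - y‖²` for all `x`, `y` and all
`z ∈ ∂φ(y)`. -/
def IsStronglyConvex (μ : ℝ) (φ : E → EReal) : Prop :=
  ∀ x y, ∀ z ∈ subdiff φ y,
    ((μ / 2 * ‖x - y‖ ^ 2 : ℝ) : EReal) ≤ fenchelCoupling φ x z

/-- A regularizer on the feasible set `X`: a proper `1`-strongly convex function whose Fenchel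
coupling is `L`-Lipschitz on `X` in its first variable. Exchanging `x` and `x'` in `lipschitz`
gives the bound on the absolute value, and `x' = a` gives finiteness on `X`. -/
structure IsRegularizer (X : Set E) (φ : E → EReal) (L : ℝ) : Prop where
  proper : IsProper φ
  strongly_convex : IsStronglyConvex 1 φ
  lipschitz : ∀ a ∈ X, ∀ z ∈ subdiff φ a, ∀ x ∈ X, ∀ x' ∈ X,
    fenchelCoupling φ x z ≤ fenchelCoupling φ x' z + ((L * ‖x - x'‖ : ℝ) : EReal)

/-- On `X`, `φ` is differentiable at `u` with gradient `z`: its directional derivative at `u`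
towards every point `x` of `X` is `⟨z, x - u⟩`. -/
def IsGradientOn (X : Set E) (φ : E → EReal) (u : E) (z : StrongDual ℝ E) : Prop :=
  ∀ x ∈ X, HasDerivWithinAt (fun s : ℝ => (φ (u + s • (x - u))).toReal) (z (x - u))
    (Set.Ici 0) 0

/-- `z` is the subgradient of `φ` that a proximal step attaches to its result `u`, where
`u` minimizes `g + B_φ(·, z₀)` over `X`. It is a subgradient of `φ` at `u`; if `φ` is
differentiable at `u` nothing else is required, and if `φ` has a kink at `u`, then it is one of
those subgradients for which the first-order condition of the step holds, that is, for which
`u` minimizes `g + ⟨z - z₀, ·⟩` over `X`. -/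
def IsStepSubgradient (X : Set E) (φ : E → EReal) (g : E → ℝ) (z₀ : StrongDual ℝ E)
    (u : E) (z : StrongDual ℝ E) : Prop :=
  z ∈ subdiff φ u ∧
    (IsGradientOn X φ u z ∨ IsMinOn (fun x => g x + (z - z₀) x) X u)

/-- `u` is the result of a minimization over `X`. -/
def IsArgMin (X : Set E) (g : E → ℝ) (u : E) : Prop := u ∈ X ∧ IsMinOn g X u

/-- `u` is the result of a maximization over `X`. -/
def IsArgMax (X : Set E) (g : E → ℝ) (u : E) : Prop := u ∈ X ∧ IsMaxOn g X u

/-- The path length `∑_{t=1}^T ‖u_t - u_{t-1}‖`. -/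
def pathLength (u : ℕ → E) (T : ℕ) : ℝ :=
  ∑ t ∈ Finset.Icc 1 T, ‖u t - u (t - 1)‖

end Convex

section Game

variable {E F : Type*} [NormedAddCommGroup E] [NormedSpace ℝ E]
  [NormedAddCommGroup F] [NormedSpace ℝ F]

/-- `(u, v)` is a saddle point of `H` on `X × Y`. -/
def IsArgMinMax (X : Set E) (Y : Set F) (H : E → F → ℝ) (u : E) (v : F) : Prop :=
  u ∈ X ∧ v ∈ Y ∧ (∀ y ∈ Y, H u y ≤ H u v) ∧ ∀ x ∈ X, H u v ≤ H x v

/-- A convex-concave function on `X × Y` with subgradients in the first variable bounded by `GX`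
and (for its negative) in the second variable bounded by `GY`. Subgradients are those of the
function on the feasible set. -/
structure IsPayoff (X : Set E) (Y : Set F) (GX GY : ℝ) (H : E → F → ℝ) : Prop where
  convex : ∀ y ∈ Y, ConvexOn ℝ X (fun x => H x y)
  concave : ∀ x ∈ X, ConcaveOn ℝ Y (fun y => H x y)
  subgrad_left : ∀ x ∈ X, ∀ y ∈ Y, ∃ g : StrongDual ℝ E, ‖g‖ ≤ GX ∧
    ∀ x' ∈ X, H x y + g (x' - x) ≤ H x' y
  subgrad_right : ∀ x ∈ X, ∀ y ∈ Y, ∃ g : StrongDual ℝ F, ‖g‖ ≤ GY ∧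
    ∀ y' ∈ Y, -H x y + g (y' - y) ≤ -H x y'

/-- `ρ(f, h) = max_{x ∈ X, y ∈ Y} |f(x, y) - h(x, y)|`. -/
def rho (X : Set E) (Y : Set F) (f h : E → F → ℝ) : ℝ :=
  sSup (Set.image2 (fun x y => |f x y - h x y|) X Y)

/-- The sequences generated by OptOPPM: strategies `x t`, `y t`, intermediate points `xt t`
(for `x̃_t`) and `yt t`, the subgradients of the regularizers at these points, `xd t` at `x t`,
`xtd t` at `xt t`, and so on, and the learning rates. -/
structure Trajectory (E F : Type*) [NormedAddCommGroup E] [NormedSpace ℝ E]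
    [NormedAddCommGroup F] [NormedSpace ℝ F] where
  x : ℕ → E
  y : ℕ → F
  xt : ℕ → E
  yt : ℕ → F
  xd : ℕ → StrongDual ℝ E
  yd : ℕ → StrongDual ℝ F
  xtd : ℕ → StrongDual ℝ E
  ytd : ℕ → StrongDual ℝ F
  η : ℕ → ℝ
  γ : ℕ → ℝ

namespace Trajectory

variable (r : Trajectory E F)

/-- `δ_t^1`. -/
def δ₁ (φ : E → EReal) (f h : ℕ → E → F → ℝ) (t : ℕ) : ℝ :=
  f t (r.x t) (r.y t) - h t (r.x t) (r.y t)
    + h t (r.xt (t + 1)) (r.y t) - f t (r.xt (t + 1)) (r.y t)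
    - coupling φ (r.xt (t + 1)) (r.xd t) / r.η t

/-- `δ_t^2`. -/
def δ₂ (ψ : F → EReal) (f h : ℕ → E → F → ℝ) (t : ℕ) : ℝ :=
  f t (r.x t) (r.yt (t + 1)) - h t (r.x t) (r.yt (t + 1))
    + h t (r.x t) (r.y t) - f t (r.x t) (r.y t)
    - coupling ψ (r.yt (t + 1)) (r.yd t) / r.γ t

/-- Individual regret of the first player against the comparators `x'`. -/
def reg₁ (f : ℕ → E → F → ℝ) (x' : ℕ → E) (T : ℕ) : ℝ :=
  ∑ t ∈ Finset.Icc 1 T, f t (r.x t) (r.y t) - ∑ t ∈ Finset.Icc 1 T, f t (x' t) (r.y t)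

/-- Individual regret of the second player against the comparators `y'`. -/
def reg₂ (f : ℕ → E → F → ℝ) (y' : ℕ → F) (T : ℕ) : ℝ :=
  ∑ t ∈ Finset.Icc 1 T, f t (r.x t) (y' t) - ∑ t ∈ Finset.Icc 1 T, f t (r.x t) (r.y t)

/-- `r` is a run of OptOPPM over the rounds `1, …, T` with payoffs `f` and predictors `h`. -/
structure IsOptOPPM (X : Set E) (Y : Set F) (φ : E → EReal) (ψ : F → EReal)
    (f h : ℕ → E → F → ℝ) (T : ℕ) : Prop where
  init_x : r.xt 1 ∈ X
  init_y : r.yt 1 ∈ Y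
  init_xd : r.xtd 1 ∈ subdiff φ (r.xt 1)
  init_yd : r.ytd 1 ∈ subdiff ψ (r.yt 1)
  strategy : ∀ t ∈ Finset.Icc 1 T,
    IsArgMinMax X Y
      (fun x y => h t x y + 1 / r.η t * coupling φ x (r.xtd t)
        - 1 / r.γ t * coupling ψ y (r.ytd t))
      (r.x t) (r.y t)
  strategy_xd : ∀ t ∈ Finset.Icc 1 T,
    IsStepSubgradient X φ (fun x => r.η t * h t x (r.y t)) (r.xtd t) (r.x t) (r.xd t)
  strategy_yd : ∀ t ∈ Finset.Icc 1 T,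
    IsStepSubgradient Y ψ (fun y => -(r.γ t * h t (r.x t) y)) (r.ytd t) (r.y t) (r.yd t)
  update_x : ∀ t ∈ Finset.Icc 1 T,
    IsArgMin X (fun x => r.η t * f t x (r.y t) + coupling φ x (r.xtd t)) (r.xt (t + 1))
  update_y : ∀ t ∈ Finset.Icc 1 T,
    IsArgMax Y (fun y => r.γ t * f t (r.x t) y - coupling ψ y (r.ytd t)) (r.yt (t + 1))
  update_xd : ∀ t ∈ Finset.Icc 1 T,
    IsStepSubgradient X φ (fun x => r.η t * f t x (r.y t)) (r.xtd t)
      (r.xt (t + 1)) (r.xtd (t + 1))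
  update_yd : ∀ t ∈ Finset.Icc 1 T,
    IsStepSubgradient Y ψ (fun y => -(r.γ t * f t (r.x t) y)) (r.ytd t)
      (r.yt (t + 1)) (r.ytd (t + 1))

/-- The adaptive learning rates, with presets `C₁` and `C₂`. -/
structure HasAdaptiveRates (X : Set E) (Y : Set F) (φ : E → EReal) (ψ : F → EReal)
    (Lφ Lψ C₁ C₂ ε : ℝ) (f h : ℕ → E → F → ℝ) (T : ℕ) : Prop where
  rate_x : ∀ t ∈ Finset.Icc 1 T,
    r.η t = Lφ * (Metric.diam X + C₁) / (ε + ∑ τ ∈ Finset.Ico 1 t, r.δ₁ φ f h τ)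
  rate_y : ∀ t ∈ Finset.Icc 1 T,
    r.γ t = Lψ * (Metric.diam Y + C₂) / (ε + ∑ τ ∈ Finset.Ico 1 t, r.δ₂ ψ f h τ)

end Trajectory

end Game

end OSP

end

/-! With the opponent's `y_t` frozen, each half of the saddle point is a proximal minimization, so
each player runs a one-player optimistic proximal method, with losses `f_t(·, y_t)` and predictions
`h_t(·, y_t)` for the first and `-f_t(x_t, ·)`, `-h_t(x_t, ·)` for the second. The whole analysis is
done once for that method (`IsOptimisticProx.regret_le`).

First-order optimality and the three-point identity give `step_le`. Applied to both steps of a round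
it yields: regret of the round ≤ `δ_t` plus `1/η_t` times a difference of couplings. Since `δ_t ≥
0`, the weights `1/η_t` are nondecreasing, and Abel summation bounds the weighted differences by
`L(D + C)/η_T`, which the choice of rates makes at most `ε + ∑ δ_t`. Hence the regret is at most `ε
+ 2 ∑ δ_t`.

Two estimates of `∑ δ_t` give the minimum. Directly, `δ_t ≤ 2ρ(f_t, h_t)`. By strong convexity `δ_t
≤ 2G²η_t`, so `δ_t` times the preceding partial sum is bounded; with `δ_t ≤ 2GD` this makes `(∑
δ_t)²` linear in `T`. -/

namespace OSP

/-! ### Fenchel couplings and the inequality of one proximal step. -/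

section Coupling

variable {E : Type*} [NormedAddCommGroup E] [NormedSpace ℝ E] {X : Set E} {φ : E → EReal}

theorem IsProper.coe_toReal_of_mem_subdiff (hφ : IsProper φ) {a : E} {z : StrongDual ℝ E}
    (hz : z ∈ subdiff φ a) : (((φ a).toReal : ℝ) : EReal) = φ a := by
  obtain ⟨b, hb⟩ := hφ.2
  refine EReal.coe_toReal ?_ (hφ.1 a)
  intro ha
  have h := hz b
  rw [ha, EReal.top_add_coe] at h
  exact hb (top_le_iff.1 h)

/-- Equality in Fenchel–Young: the subgradient inequality says exactly that the supremum is attained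
at `a`. -/
theorem IsProper.conjugate_eq (hφ : IsProper φ) {a : E} {z : StrongDual ℝ E}
    (hz : z ∈ subdiff φ a) :
    conjugate φ z = ((z a - (φ a).toReal : ℝ) : EReal) := by
  have ha := hφ.coe_toReal_of_mem_subdiff hz
  apply le_antisymm
  · refine iSup_le fun x => ?_
    have h := hz x
    rw [← ha] at h
    by_cases hx : φ x = ⊤
    · simp [hx]
    · rw [← EReal.coe_toReal hx (hφ.1 x)] at h ⊢
      norm_cast at h ⊢
      rw [map_sub] at h
      linarith
  · have h := le_iSup (fun x => ((z x : ℝ) : EReal) - φ x) a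
    rw [EReal.coe_sub, ha]
    exact h

namespace IsRegularizer

variable {L : ℝ}

/-- The Lipschitz bound compared with the point `a`, where the coupling is finite, excludes the
value `⊤` on `X`. -/
theorem coe_toReal (hφ : IsRegularizer X φ L) {a : E} (ha : a ∈ X) {z : StrongDual ℝ E}
    (hz : z ∈ subdiff φ a) {x : E} (hx : x ∈ X) : (((φ x).toReal : ℝ) : EReal) = φ x := by
  refine EReal.coe_toReal ?_ (hφ.proper.1 x)
  intro htop
  have h := hφ.lipschitz a ha z hz x hx a ha
  unfold fenchelCoupling at h
  rw [htop, hφ.proper.conjugate_eq hz, ← hφ.proper.coe_toReal_of_mem_subdiff hz,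
    EReal.top_add_coe, EReal.top_sub_coe] at h
  norm_cast at h

/-- On `X` the coupling is the Bregman divergence based at `a`; from here on all computations are
real. -/
theorem fenchelCoupling_eq (hφ : IsRegularizer X φ L) {a : E} (ha : a ∈ X)
    {z : StrongDual ℝ E} (hz : z ∈ subdiff φ a) {x : E} (hx : x ∈ X) :
    fenchelCoupling φ x z = (((φ x).toReal - (φ a).toReal - z (x - a) : ℝ) : EReal) := by
  unfold fenchelCoupling
  rw [hφ.proper.conjugate_eq hz, ← hφ.coe_toReal ha hz hx, EReal.toReal_coe]
  norm_cast
  rw [map_sub]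
  ring

theorem coupling_eq (hφ : IsRegularizer X φ L) {a : E} (ha : a ∈ X)
    {z : StrongDual ℝ E} (hz : z ∈ subdiff φ a) {x : E} (hx : x ∈ X) :
    coupling φ x z = (φ x).toReal - (φ a).toReal - z (x - a) := by
  rw [coupling, hφ.fenchelCoupling_eq ha hz hx, EReal.toReal_coe]

theorem coe_coupling (hφ : IsRegularizer X φ L) {a : E} (ha : a ∈ X)
    {z : StrongDual ℝ E} (hz : z ∈ subdiff φ a) {x : E} (hx : x ∈ X) :
    (coupling φ x z : EReal) = fenchelCoupling φ x z := by
  rw [hφ.coupling_eq ha hz hx, hφ.fenchelCoupling_eq ha hz hx]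

theorem coupling_self (hφ : IsRegularizer X φ L) {a : E} (ha : a ∈ X)
    {z : StrongDual ℝ E} (hz : z ∈ subdiff φ a) : coupling φ a z = 0 := by
  rw [hφ.coupling_eq ha hz ha]; simp

theorem half_sq_le_coupling (hφ : IsRegularizer X φ L) {a : E} (ha : a ∈ X)
    {z : StrongDual ℝ E} (hz : z ∈ subdiff φ a) {x : E} (hx : x ∈ X) :
    1 / 2 * ‖x - a‖ ^ 2 ≤ coupling φ x z := by
  have h := hφ.strongly_convex x a z hz
  rw [← hφ.coe_coupling ha hz hx] at h
  exact_mod_cast h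

theorem coupling_nonneg (hφ : IsRegularizer X φ L) {a : E} (ha : a ∈ X)
    {z : StrongDual ℝ E} (hz : z ∈ subdiff φ a) {x : E} (hx : x ∈ X) :
    0 ≤ coupling φ x z :=
  le_trans (by positivity) (hφ.half_sq_le_coupling ha hz hx)

theorem coupling_le_add (hφ : IsRegularizer X φ L) {a : E} (ha : a ∈ X)
    {z : StrongDual ℝ E} (hz : z ∈ subdiff φ a) {x y : E} (hx : x ∈ X) (hy : y ∈ X) :
    coupling φ x z ≤ coupling φ y z + L * ‖x - y‖ := by
  have h := hφ.lipschitz a ha z hz x hx y hy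
  rw [← hφ.coe_coupling ha hz hx, ← hφ.coe_coupling ha hz hy] at h
  exact_mod_cast h

/-- The Lipschitz constant of a regularizer is positive on a set with more than one point. -/
theorem lipschitz_pos (hφ : IsRegularizer X φ L) (hX : X.Nontrivial) {a : E} (ha : a ∈ X)
    {z : StrongDual ℝ E} (hz : z ∈ subdiff φ a) : 0 < L := by
  obtain ⟨x, hx, hxa⟩ := hX.exists_ne a
  have h₁ := hφ.half_sq_le_coupling ha hz hx
  have h₂ := hφ.coupling_le_add ha hz hx ha
  rw [hφ.coupling_self ha hz] at h₂
  have h₃ : 0 < ‖x - a‖ := norm_pos_iff.2 (sub_ne_zero.2 hxa)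
  by_contra hL
  nlinarith [mul_nonneg (sub_nonneg.2 (not_lt.1 hL)) h₃.le, pow_pos h₃ 2]

/-- The three-point identity for the Fenchel coupling. -/
theorem three_point (hφ : IsRegularizer X φ L) {a u x : E} (ha : a ∈ X) (hu : u ∈ X)
    (hx : x ∈ X) {z₀ z : StrongDual ℝ E} (hz₀ : z₀ ∈ subdiff φ a) (hz : z ∈ subdiff φ u) :
    (z - z₀) x - (z - z₀) u
      = coupling φ x z₀ - coupling φ x z - coupling φ u z₀ := by
  rw [hφ.coupling_eq ha hz₀ hx, hφ.coupling_eq hu hz hx, hφ.coupling_eq ha hz₀ hu]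
  simp only [map_sub, sub_apply]
  ring

/-- The first-order optimality condition of a proximal step. -/
theorem step_optimality (hφ : IsRegularizer X φ L) (hX : Convex ℝ X) {g : E → ℝ}
    (hg : ConvexOn ℝ X g) {a u : E} (ha : a ∈ X) (hu : u ∈ X) {z₀ z : StrongDual ℝ E}
    (hz₀ : z₀ ∈ subdiff φ a) (hmin : IsMinOn (fun x => g x + coupling φ x z₀) X u)
    (hz : IsStepSubgradient X φ g z₀ u z) :
    IsMinOn (fun x => g x + (z - z₀) x) X u := by
  rcases hz.2 with hgrad | h
  swap
  · exact h
  intro x hx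
  have hd := hasDerivWithinAt_iff_tendsto_slope.1 (hgrad x hx)
  have hsub : Set.Ici (0 : ℝ) \ {0} = Set.Ioi 0 := by
    ext s; simp [lt_iff_le_and_ne, eq_comm]
  rw [hsub] at hd
  -- Minimality of `u` against the point `u + s(x - u)` and convexity of `g` on the segment bound
  -- the difference quotient of `φ` from below; letting `s → 0+` turns the quotient into `z (x -
  -- u)`.
  have hev : ∀ᶠ s in nhdsWithin (0 : ℝ) (Set.Ioi 0), g u - g x + z₀ (x - u)
      ≤ slope (fun s : ℝ => (φ (u + s • (x - u))).toReal) 0 s := by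
    filter_upwards [Ioc_mem_nhdsGT (zero_lt_one' ℝ)] with s hs
    have hw : u + s • (x - u) ∈ X := hX.add_smul_sub_mem hu hx ⟨hs.1.le, hs.2⟩
    have h₁ := hmin hw
    simp only [Set.mem_ofPred_eq] at h₁
    rw [hφ.coupling_eq ha hz₀ hu, hφ.coupling_eq ha hz₀ hw] at h₁
    have h₂ := hg.2 hu hx (sub_nonneg.2 hs.2) hs.1.le (sub_add_cancel 1 s)
    have e : (1 - s) • u + s • x = u + s • (x - u) := by module
    rw [e, smul_eq_mul, smul_eq_mul] at h₂
    rw [slope_def_field, le_div_iff₀ (by simpa using hs.1)]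
    simp only [map_sub, map_add, map_smul, smul_eq_mul, zero_smul, add_zero, sub_zero] at h₁ ⊢
    linarith
  have h := ge_of_tendsto hd hev
  simp only [Set.mem_ofPred_eq, sub_apply, map_sub] at h ⊢
  linarith

/-- The regret inequality of a proximal step. -/
theorem step_le (hφ : IsRegularizer X φ L) (hX : Convex ℝ X) {g : E → ℝ}
    (hg : ConvexOn ℝ X g) {a u x : E} (ha : a ∈ X) (hu : u ∈ X) (hx : x ∈ X)
    {z₀ z : StrongDual ℝ E} (hz₀ : z₀ ∈ subdiff φ a)
    (hmin : IsMinOn (fun x => g x + coupling φ x z₀) X u)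
    (hz : IsStepSubgradient X φ g z₀ u z) :
    g u - g x ≤ coupling φ x z₀ - coupling φ x z - coupling φ u z₀ := by
  have h := hφ.step_optimality hX hg ha hu hz₀ hmin hz hx
  simp only [Set.mem_ofPred_eq] at h
  linarith [hφ.three_point ha hu hx hz₀ hz.1]

end IsRegularizer

end Coupling

/-! ### Two summation inequalities for real sequences. -/

section Summation

/-- Abel summation with nondecreasing weights. -/
theorem sum_weighted_drift_le {α β b d : ℕ → ℝ} {M : ℝ} {T : ℕ}
    (hb₀ : ∀ t ∈ Finset.Icc 1 T, 0 ≤ b t)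
    (hb : ∀ t ∈ Finset.Icc 1 T, t + 1 ∈ Finset.Icc 1 T → b t ≤ b (t + 1))
    (hd : ∀ t, 0 ≤ d t)
    (hβ : ∀ t ≤ T, β t ≤ M)
    (hα : ∀ t ∈ Finset.Icc 1 T, α t ≤ β (t - 1) + d t) (n : ℕ) (hn : n + 1 ≤ T) :
    ∑ t ∈ Finset.Icc 1 (n + 1), b t * (α t - β t)
      ≤ b (n + 1) * (M + ∑ t ∈ Finset.Icc 1 (n + 1), d t - β (n + 1)) := by
  induction n with
  | zero =>
    have h1 : 1 ∈ Finset.Icc 1 T := by simp; omega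
    have h := hα 1 h1
    have h' := hβ 0 (Nat.zero_le _)
    simp only [zero_add, Finset.Icc_self, Finset.sum_singleton, Nat.sub_self] at h ⊢
    exact mul_le_mul_of_nonneg_left (by linarith) (hb₀ 1 h1)
  | succ n ih =>
    have hm : n + 1 ∈ Finset.Icc 1 T := by simp; omega
    have hm' : n + 1 + 1 ∈ Finset.Icc 1 T := by simp; omega
    rw [Finset.sum_Icc_succ_top (by omega),
      Finset.sum_Icc_succ_top (b := n + 1) (f := d) (by omega)]
    have h := hα _ hm'
    rw [Nat.add_sub_cancel] at h
    have h₁ := mul_le_mul_of_nonneg_left h (hb₀ _ hm')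
    -- Nonnegativity of the bracket, from `β ≤ M`, allows its weight to be raised from `b (n + 1)`
    -- to `b (n + 2)`; its `-β (n + 1)` then cancels the `β (n + 1)` that bounds `α (n + 2)`.
    have h₂ : 0 ≤ M + ∑ t ∈ Finset.Icc 1 (n + 1), d t - β (n + 1) := by
      have := Finset.sum_nonneg (s := Finset.Icc 1 (n + 1)) fun t _ => hd t
      linarith [hβ (n + 1) (by omega)]
    have h₃ := mul_le_mul_of_nonneg_right (hb _ hm hm') h₂
    linarith [ih (by omega)]

/-- A sum whose terms are bounded by `a` and by `c` over the preceding partial sum grows like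
the square root of the number of terms. -/
theorem sq_sum_le_of_self_bounded {δ : ℕ → ℝ} {a c : ℝ} (n : ℕ)
    (h₀ : ∀ t ∈ Finset.Icc 1 n, 0 ≤ δ t) (h₁ : ∀ t ∈ Finset.Icc 1 n, δ t ≤ a)
    (h₂ : ∀ t ∈ Finset.Icc 1 n, δ t * ∑ τ ∈ Finset.Ico 1 t, δ τ ≤ c) :
    (∑ t ∈ Finset.Icc 1 n, δ t) ^ 2 ≤ n * (a ^ 2 + 2 * c) := by
  induction n with
  | zero => simp
  | succ n ih =>
    have hsub : Finset.Icc 1 n ⊆ Finset.Icc 1 (n + 1) :=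
      Finset.Icc_subset_Icc_right (Nat.le_succ n)
    have hm : n + 1 ∈ Finset.Icc 1 (n + 1) := by simp
    have h := ih (fun t ht => h₀ t (hsub ht)) (fun t ht => h₁ t (hsub ht))
      (fun t ht => h₂ t (hsub ht))
    have h' := h₂ _ hm
    have hI : Finset.Ico 1 (n + 1) = Finset.Icc 1 n := by ext; simp
    rw [hI] at h'
    -- From `(S + δ)² = S² + δ² + 2δS`, each new term adds at most `a² + 2c` to the square.
    have hsq := pow_le_pow_left₀ (h₀ _ hm) (h₁ _ hm) 2
    rw [Finset.sum_Icc_succ_top (by omega)]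
    push_cast
    linarith

end Summation

/-! ### The one-player optimistic proximal method: estimates for one round. -/

section SinglePlayer

variable {E : Type*} [NormedAddCommGroup E] [NormedSpace ℝ E]

/-- A loss on `X`: convex and `G`-Lipschitz. -/
structure IsLoss (X : Set E) (G : ℝ) (g : E → ℝ) : Prop where
  convex : ConvexOn ℝ X g
  lipschitz : ∀ a ∈ X, ∀ b ∈ X, g a - g b ≤ G * ‖a - b‖

/-- One player's share of a run of the optimistic proximal point method, with losses `f` and
predicted losses `h`. -/
structure IsOptimisticProx (X : Set E) (φ : E → EReal) (f h : ℕ → E → ℝ) (T : ℕ)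
    (x xt : ℕ → E) (xd xtd : ℕ → StrongDual ℝ E) (η : ℕ → ℝ) : Prop where
  init_mem : xt 1 ∈ X
  init_subdiff : xtd 1 ∈ subdiff φ (xt 1)
  strategy : ∀ t ∈ Finset.Icc 1 T,
    IsArgMin X (fun u => h t u + 1 / η t * coupling φ u (xtd t)) (x t)
  strategy_subgradient : ∀ t ∈ Finset.Icc 1 T,
    IsStepSubgradient X φ (fun u => η t * h t u) (xtd t) (x t) (xd t)
  update : ∀ t ∈ Finset.Icc 1 T,
    IsArgMin X (fun u => η t * f t u + coupling φ u (xtd t)) (xt (t + 1))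
  update_subgradient : ∀ t ∈ Finset.Icc 1 T,
    IsStepSubgradient X φ (fun u => η t * f t u) (xtd t) (xt (t + 1)) (xtd (t + 1))

/-- The quantity that drives the adaptive learning rate of one player. -/
noncomputable def proxGap (φ : E → EReal) (f h : ℕ → E → ℝ) (x xt : ℕ → E) (xd : ℕ → StrongDual ℝ E)
    (η : ℕ → ℝ) (t : ℕ) : ℝ :=
  f t (x t) - h t (x t) + h t (xt (t + 1)) - f t (xt (t + 1))
    - coupling φ (xt (t + 1)) (xd t) / η t

namespace IsOptimisticProx

variable {X : Set E} {φ : E → EReal} {f h : ℕ → E → ℝ} {T : ℕ} {x xt : ℕ → E}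
  {xd xtd : ℕ → StrongDual ℝ E} {η : ℕ → ℝ} {L G : ℝ}

theorem xt_mem (hr : IsOptimisticProx X φ f h T x xt xd xtd η) {t : ℕ} (ht : t ≤ T) :
    xt (t + 1) ∈ X ∧ xtd (t + 1) ∈ subdiff φ (xt (t + 1)) := by
  rcases Nat.eq_zero_or_pos t with rfl | h0
  · exact ⟨hr.init_mem, hr.init_subdiff⟩
  · have hm : t ∈ Finset.Icc 1 T := Finset.mem_Icc.2 ⟨h0, ht⟩
    exact ⟨(hr.update t hm).1, (hr.update_subgradient t hm).1⟩

theorem xt_mem' (hr : IsOptimisticProx X φ f h T x xt xd xtd η) {t : ℕ}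
    (ht : t ∈ Finset.Icc 1 T) : xt t ∈ X ∧ xtd t ∈ subdiff φ (xt t) := by
  obtain ⟨h1, h2⟩ := Finset.mem_Icc.1 ht
  obtain ⟨s, rfl⟩ := Nat.exists_eq_add_of_le' h1
  exact hr.xt_mem (by omega)

theorem strategy_le (hr : IsOptimisticProx X φ f h T x xt xd xtd η)
    (hφ : IsRegularizer X φ L) (hX : Convex ℝ X) {t : ℕ} (ht : t ∈ Finset.Icc 1 T)
    (hh : IsLoss X G (h t)) (hη : 0 < η t) {u : E} (hu : u ∈ X) :
    η t * h t (x t) - η t * h t u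
      ≤ coupling φ u (xtd t) - coupling φ u (xd t) - coupling φ (x t) (xtd t) := by
  obtain ⟨ha, hza⟩ := hr.xt_mem' ht
  refine hφ.step_le hX (hh.convex.smul hη.le) ha (hr.strategy t ht).1 hu hza ?_
    (hr.strategy_subgradient t ht)
  -- The strategy minimizes `h + B/η`; multiplying by `η > 0` brings it to the form `ηh + B` of a
  -- proximal step.
  intro v hv
  have h := mul_le_mul_of_nonneg_left ((hr.strategy t ht).2 hv) hη.le
  have e : ∀ c : ℝ, η t * (1 / η t * c) = c := fun c => by field_simp
  simp only [mul_add, e] at h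
  exact h

theorem update_le (hr : IsOptimisticProx X φ f h T x xt xd xtd η)
    (hφ : IsRegularizer X φ L) (hX : Convex ℝ X) {t : ℕ} (ht : t ∈ Finset.Icc 1 T)
    (hf : IsLoss X G (f t)) (hη : 0 < η t) {u : E} (hu : u ∈ X) :
    η t * f t (xt (t + 1)) - η t * f t u
      ≤ coupling φ u (xtd t) - coupling φ u (xtd (t + 1))
        - coupling φ (xt (t + 1)) (xtd t) := by
  obtain ⟨ha, hza⟩ := hr.xt_mem' ht
  exact hφ.step_le hX (hf.convex.smul hη.le) ha (hr.update t ht).1 hu hza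
    (hr.update t ht).2 (hr.update_subgradient t ht)

theorem mul_proxGap (t : ℕ) (hη : 0 < η t) :
    η t * proxGap φ f h x xt xd η t = η t * f t (x t) - η t * h t (x t)
      + η t * h t (xt (t + 1)) - η t * f t (xt (t + 1)) - coupling φ (xt (t + 1)) (xd t) := by
  unfold proxGap
  field_simp

/-- The strategy inequality tested at the updated point, added to minimality of the updated point
tested at the strategy: all couplings cancel. -/
theorem proxGap_nonneg (hr : IsOptimisticProx X φ f h T x xt xd xtd η)
    (hφ : IsRegularizer X φ L) (hX : Convex ℝ X) {t : ℕ} (ht : t ∈ Finset.Icc 1 T)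
    (hh : IsLoss X G (h t)) (hη : 0 < η t) :
    0 ≤ proxGap φ f h x xt xd η t := by
  have h₁ := hr.strategy_le hφ hX ht hh hη (hr.update t ht).1
  have h₂ : η t * f t (xt (t + 1)) + coupling φ (xt (t + 1)) (xtd t)
      ≤ η t * f t (x t) + coupling φ (x t) (xtd t) :=
    (hr.update t ht).2 (hr.strategy t ht).1
  refine nonneg_of_mul_nonneg_right ?_ hη
  rw [mul_proxGap t hη]
  linarith

/-- The strategy step is tested at the updated point and the update step at `u`. In the sum the
couplings at the updated point cancel, and the nonnegative coupling at the strategy is dropped. -/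
theorem regret_step_le (hr : IsOptimisticProx X φ f h T x xt xd xtd η)
    (hφ : IsRegularizer X φ L) (hX : Convex ℝ X) {t : ℕ} (ht : t ∈ Finset.Icc 1 T)
    (hf : IsLoss X G (f t)) (hh : IsLoss X G (h t)) (hη : 0 < η t) {u : E} (hu : u ∈ X) :
    f t (x t) - f t u ≤ proxGap φ f h x xt xd η t
      + 1 / η t * (coupling φ u (xtd t) - coupling φ u (xtd (t + 1))) := by
  obtain ⟨ha, hza⟩ := hr.xt_mem' ht
  have h₁ := hr.strategy_le hφ hX ht hh hη (hr.update t ht).1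
  have h₂ := hr.update_le hφ hX ht hf hη hu
  have h₃ := hφ.coupling_nonneg ha hza (hr.strategy t ht).1
  refine le_of_mul_le_mul_left ?_ hη
  have e : ∀ c : ℝ, η t * (1 / η t * c) = c := fun c => by field_simp
  rw [mul_add, e, mul_proxGap t hη]
  linarith

theorem proxGap_le_two_mul (hr : IsOptimisticProx X φ f h T x xt xd xtd η)
    (hφ : IsRegularizer X φ L) {t : ℕ} (ht : t ∈ Finset.Icc 1 T) (hη : 0 < η t) {R : ℝ}
    (hR : ∀ u ∈ X, |f t u - h t u| ≤ R) : proxGap φ f h x xt xd η t ≤ 2 * R := by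
  have h₁ := abs_le.1 (hR _ (hr.strategy t ht).1)
  have h₂ := abs_le.1 (hR _ (hr.update t ht).1)
  have h₃ := div_nonneg (hφ.coupling_nonneg (hr.strategy t ht).1
    (hr.strategy_subgradient t ht).1 (hr.update t ht).1) hη.le
  unfold proxGap
  linarith

/-- The Lipschitz bounds of `f t` and `h t` between the two points each contribute `G` times the
distance; strong convexity supplies the negative square. -/
theorem proxGap_le_sub_sq (hr : IsOptimisticProx X φ f h T x xt xd xtd η)
    (hφ : IsRegularizer X φ L) {t : ℕ} (ht : t ∈ Finset.Icc 1 T)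
    (hf : IsLoss X G (f t)) (hh : IsLoss X G (h t)) (hη : 0 < η t) :
    proxGap φ f h x xt xd η t ≤ 2 * G * ‖xt (t + 1) - x t‖
      - 1 / 2 * ‖xt (t + 1) - x t‖ ^ 2 / η t := by
  have hx := (hr.strategy t ht).1
  have hxt := (hr.update t ht).1
  have h₁ := hf.lipschitz _ hx _ hxt
  have h₂ := hh.lipschitz _ hxt _ hx
  have h₃ := div_le_div_of_nonneg_right
    (hφ.half_sq_le_coupling hx (hr.strategy_subgradient t ht).1 hxt) hη.le
  rw [norm_sub_rev] at h₁
  unfold proxGap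
  linarith

theorem proxGap_le_rate (hr : IsOptimisticProx X φ f h T x xt xd xtd η)
    (hφ : IsRegularizer X φ L) {t : ℕ} (ht : t ∈ Finset.Icc 1 T)
    (hf : IsLoss X G (f t)) (hh : IsLoss X G (h t)) (hη : 0 < η t) :
    proxGap φ f h x xt xd η t ≤ 2 * G ^ 2 * η t := by
  refine (hr.proxGap_le_sub_sq hφ ht hf hh hη).trans ?_
  rw [sub_le_iff_le_add, ← sub_le_iff_le_add', le_div_iff₀ hη]
  -- The quadratic `2Gr - r²/(2η)` is largest at `r = 2Gη`.
  nlinarith [sq_nonneg (‖xt (t + 1) - x t‖ - 2 * G * η t)]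

theorem proxGap_le_diam (hr : IsOptimisticProx X φ f h T x xt xd xtd η)
    (hφ : IsRegularizer X φ L) (hc : IsCompact X) (hG : 0 ≤ G) {t : ℕ}
    (ht : t ∈ Finset.Icc 1 T)
    (hf : IsLoss X G (f t)) (hh : IsLoss X G (h t)) (hη : 0 < η t) :
    proxGap φ f h x xt xd η t ≤ 2 * G * Metric.diam X := by
  have h₁ := hr.proxGap_le_sub_sq hφ ht hf hh hη
  have h₂ : ‖xt (t + 1) - x t‖ ≤ Metric.diam X := by
    rw [← dist_eq_norm]
    exact Metric.dist_le_diam_of_mem hc.isBounded (hr.update t ht).1 (hr.strategy t ht).1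
  have h₃ := mul_le_mul_of_nonneg_left h₂ (by positivity : 0 ≤ 2 * G)
  have h₄ : 0 ≤ 1 / 2 * ‖xt (t + 1) - x t‖ ^ 2 / η t := by positivity
  linarith

/-! ### Adaptive rates and summation over the rounds. -/

variable {C ε : ℝ}

/-- Positivity of a rate needs the earlier gaps to be nonnegative, which in turn needs the earlier
rates to be positive; hence strong induction. -/
theorem rate_pos (hr : IsOptimisticProx X φ f h T x xt xd xtd η)
    (hφ : IsRegularizer X φ L) (hX : Convex ℝ X)
    (hh : ∀ t ∈ Finset.Icc 1 T, IsLoss X G (h t)) (hε : 0 < ε)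
    {A : ℝ} (hA : 0 < A)
    (hη : ∀ t ∈ Finset.Icc 1 T,
      η t = A / (ε + ∑ τ ∈ Finset.Ico 1 t, proxGap φ f h x xt xd η τ))
    {t : ℕ} (ht : t ∈ Finset.Icc 1 T) : 0 < η t := by
  induction t using Nat.strong_induction_on with
  | _ t ih =>
    rw [hη t ht]
    refine div_pos hA (add_pos_of_pos_of_nonneg hε (Finset.sum_nonneg fun τ hτ => ?_))
    have h₁ := Finset.mem_Ico.1 hτ
    have hm : τ ∈ Finset.Icc 1 T :=
      Finset.mem_Icc.2 ⟨h₁.1, h₁.2.le.trans (Finset.mem_Icc.1 ht).2⟩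
    exact hr.proxGap_nonneg hφ hX hm (hh τ hm) (ih τ h₁.2 hm)

/-- Dynamic regret is controlled by the accumulated gaps. -/
theorem regret_le_sum_proxGap (hr : IsOptimisticProx X φ f h T x xt xd xtd η)
    (hφ : IsRegularizer X φ L) (hX : Convex ℝ X) (hc : IsCompact X)
    (hf : ∀ t ∈ Finset.Icc 1 T, IsLoss X G (f t))
    (hh : ∀ t ∈ Finset.Icc 1 T, IsLoss X G (h t)) (hε : 0 < ε) (hL : 0 < L)
    (hA : 0 < L * (Metric.diam X + C))
    (hη : ∀ t ∈ Finset.Icc 1 T, η t = L * (Metric.diam X + C) /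
      (ε + ∑ τ ∈ Finset.Ico 1 t, proxGap φ f h x xt xd η τ))
    {x' : ℕ → E} (hx' : ∀ t ≤ T, x' t ∈ X) (hC : pathLength x' T ≤ C) :
    ∑ t ∈ Finset.Icc 1 T, (f t (x t) - f t (x' t))
      ≤ ε + 2 * ∑ t ∈ Finset.Icc 1 T, proxGap φ f h x xt xd η t := by
  have hpos : ∀ t ∈ Finset.Icc 1 T, 0 < η t := fun t ht =>
    hr.rate_pos hφ hX hh hε hA hη ht
  have hδ : ∀ t ∈ Finset.Icc 1 T, 0 ≤ proxGap φ f h x xt xd η t := fun t ht =>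
    hr.proxGap_nonneg hφ hX ht (hh t ht) (hpos t ht)
  rcases T with _ | n
  · simp [hε.le]
  have hinv : ∀ t ∈ Finset.Icc 1 (n + 1), 1 / η t =
      (ε + ∑ τ ∈ Finset.Ico 1 t, proxGap φ f h x xt xd η τ) / (L * (Metric.diam X + C)) := by
    intro t ht
    rw [hη t ht, one_div_div]
  -- `α t` and `β (t - 1)` use the same subgradient `xtd t` at consecutive comparators, so they
  -- differ by at most the Lipschitz drift. `M` bounds `β` because the coupling vanishes at its base
  -- point.
  have habel := sum_weighted_drift_le (T := n + 1) (b := fun t => 1 / η t)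
    (α := fun t => coupling φ (x' t) (xtd t)) (β := fun t => coupling φ (x' t) (xtd (t + 1)))
    (d := fun t => L * ‖x' t - x' (t - 1)‖) (M := L * Metric.diam X)
    (fun t ht => (one_div_pos.2 (hpos t ht)).le)
    (fun t ht ht' => by
      rw [hinv t ht, hinv _ ht', Finset.sum_Ico_succ_top (Finset.mem_Icc.1 ht).1]
      gcongr
      linarith [hδ t ht])
    (fun t => by positivity)
    (fun t ht => by
      obtain ⟨ha, hza⟩ := hr.xt_mem ht
      have h₁ := hφ.coupling_le_add ha hza (hx' t ht) ha
      rw [hφ.coupling_self ha hza, zero_add, ← dist_eq_norm] at h₁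
      exact h₁.trans (mul_le_mul_of_nonneg_left
        (Metric.dist_le_diam_of_mem hc.isBounded (hx' t ht) ha) hL.le))
    (fun t ht => by
      obtain ⟨h1, h2⟩ := Finset.mem_Icc.1 ht
      obtain ⟨ha, hza⟩ := hr.xt_mem' ht
      have h₁ := hφ.coupling_le_add ha hza (hx' t h2) (hx' (t - 1) (by omega))
      rwa [Nat.sub_add_cancel h1])
    n le_rfl
  have hm : n + 1 ∈ Finset.Icc 1 (n + 1) := by simp
  obtain ⟨ha, hza⟩ := hr.xt_mem (le_refl (n + 1))
  have hβ := hφ.coupling_nonneg ha hza (hx' _ le_rfl)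
  have hlast : 1 / η (n + 1) * (L * Metric.diam X
      + ∑ t ∈ Finset.Icc 1 (n + 1), L * ‖x' t - x' (t - 1)‖
      - coupling φ (x' (n + 1)) (xtd (n + 1 + 1)))
      ≤ ε + ∑ t ∈ Finset.Icc 1 (n + 1), proxGap φ f h x xt xd η t := by
    have h₁ : L * Metric.diam X + ∑ t ∈ Finset.Icc 1 (n + 1), L * ‖x' t - x' (t - 1)‖
        - coupling φ (x' (n + 1)) (xtd (n + 1 + 1)) ≤ L * (Metric.diam X + C) := by
      rw [← Finset.mul_sum]
      have := mul_le_mul_of_nonneg_left hC hL.le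
      unfold pathLength at this
      linarith
    -- The numerator of the rate cancels `L(D + C)` exactly, leaving `ε` plus the gaps before the
    -- last round.
    refine (mul_le_mul_of_nonneg_left h₁ (one_div_pos.2 (hpos _ hm)).le).trans ?_
    rw [hinv _ hm, div_mul_cancel₀ _ hA.ne', Finset.sum_Icc_succ_top (by omega)]
    have hI : Finset.Ico 1 (n + 1) = Finset.Icc 1 n := by ext; simp
    rw [hI]
    linarith [hδ _ hm]
  have hsum := Finset.sum_le_sum fun t ht => hr.regret_step_le hφ hX ht (hf t ht) (hh t ht)
    (hpos t ht) (hx' t (Finset.mem_Icc.1 ht).2)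
  rw [Finset.sum_add_distrib] at hsum
  linarith

theorem sum_proxGap_le_sqrt (hr : IsOptimisticProx X φ f h T x xt xd xtd η)
    (hφ : IsRegularizer X φ L) (hX : Convex ℝ X) (hc : IsCompact X) (hG : 0 ≤ G)
    (hf : ∀ t ∈ Finset.Icc 1 T, IsLoss X G (f t))
    (hh : ∀ t ∈ Finset.Icc 1 T, IsLoss X G (h t)) (hε : 0 < ε) (hL : 0 < L) (hC : 0 ≤ C)
    (hA : 0 < L * (Metric.diam X + C))
    (hη : ∀ t ∈ Finset.Icc 1 T, η t = L * (Metric.diam X + C) /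
      (ε + ∑ τ ∈ Finset.Ico 1 t, proxGap φ f h x xt xd η τ)) :
    ∑ t ∈ Finset.Icc 1 T, proxGap φ f h x xt xd η t
      ≤ Real.sqrt (4 * G ^ 2 * Metric.diam X ^ 2 + 4 * G ^ 2 * L * (Metric.diam X + 1))
        * Real.sqrt ((1 + C) * T) := by
  have hpos : ∀ t ∈ Finset.Icc 1 T, 0 < η t := fun t ht =>
    hr.rate_pos hφ hX hh hε hA hη ht
  have hδ : ∀ t ∈ Finset.Icc 1 T, 0 ≤ proxGap φ f h x xt xd η t := fun t ht =>
    hr.proxGap_nonneg hφ hX ht (hh t ht) (hpos t ht)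
  have hD : 0 ≤ Metric.diam X := Metric.diam_nonneg
  have hsq := sq_sum_le_of_self_bounded (a := 2 * G * Metric.diam X)
    (c := 2 * G ^ 2 * (L * (Metric.diam X + C))) T hδ
    (fun t ht => hr.proxGap_le_diam hφ hc hG ht (hf t ht) (hh t ht) (hpos t ht))
    (fun t ht => by
      have h₁ := hr.proxGap_le_rate hφ ht (hf t ht) (hh t ht) (hpos t ht)
      have hS : 0 < ε + ∑ τ ∈ Finset.Ico 1 t, proxGap φ f h x xt xd η τ := by
        have h₂ := hpos t ht
        rw [hη t ht] at h₂
        exact (div_pos_iff_of_pos_left hA).1 h₂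
      -- Multiplying the bound `2G²η` by the denominator of `η` leaves the constant `2G²L(D + C)`;
      -- the term with `ε` is then discarded.
      have h₃ := mul_le_mul_of_nonneg_right h₁ hS.le
      have h₄ : η t * (ε + ∑ τ ∈ Finset.Ico 1 t, proxGap φ f h x xt xd η τ)
          = L * (Metric.diam X + C) := by
        conv_lhs => rw [hη t ht]
        exact div_mul_cancel₀ _ hS.ne'
      rw [mul_assoc (2 * G ^ 2), h₄] at h₃
      linarith [mul_nonneg (hδ t ht) hε.le])
  rw [← Real.sqrt_mul (by positivity)]
  refine Real.le_sqrt_of_sq_le (hsq.trans ?_)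
  -- These two terms are the surplus in replacing `D²` by `D²(1 + C)` and `D + C` by `(D + 1)(1 +
  -- C)`.
  have h₁ : 0 ≤ (T : ℝ) * (4 * G ^ 2 * Metric.diam X ^ 2 * C) := by positivity
  have h₂ : 0 ≤ (T : ℝ) * (4 * G ^ 2 * L * (1 + Metric.diam X * C)) := by positivity
  linarith

/-- The regret bound for one player. -/
theorem regret_le (hr : IsOptimisticProx X φ f h T x xt xd xtd η)
    (hφ : IsRegularizer X φ L) (hX : Convex ℝ X) (hc : IsCompact X) (hG : 0 < T → 0 ≤ G)
    (hf : ∀ t ∈ Finset.Icc 1 T, IsLoss X G (f t))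
    (hh : ∀ t ∈ Finset.Icc 1 T, IsLoss X G (h t)) (hε : 0 < ε)
    (hη : ∀ t ∈ Finset.Icc 1 T, η t = L * (Metric.diam X + C) /
      (ε + ∑ τ ∈ Finset.Ico 1 t, proxGap φ f h x xt xd η τ))
    {x' : ℕ → E} (hx' : ∀ t ≤ T, x' t ∈ X) (hC : pathLength x' T ≤ C)
    {R : ℕ → ℝ} (hR : ∀ t ∈ Finset.Icc 1 T, ∀ u ∈ X, |f t u - h t u| ≤ R t)
    {K : ℝ} (hK₁ : 4 ≤ K)
    (hK₂ : 2 * Real.sqrt (4 * G ^ 2 * Metric.diam X ^ 2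
      + 4 * G ^ 2 * L * (Metric.diam X + 1)) ≤ K) :
    (∀ t ∈ Finset.Icc 1 T, 0 ≤ proxGap φ f h x xt xd η t) ∧
    ∑ t ∈ Finset.Icc 1 T, (f t (x t) - f t (x' t))
      ≤ ε + K * min (∑ t ∈ Finset.Icc 1 T, R t) (Real.sqrt ((1 + C) * T)) := by
  have hR₀ : 0 ≤ ∑ t ∈ Finset.Icc 1 T, R t := Finset.sum_nonneg fun t ht =>
    (abs_nonneg _).trans (hR t ht _ hr.init_mem)
  have hC₀ : 0 ≤ C := le_trans (Finset.sum_nonneg fun t _ => norm_nonneg _) hC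
  have hrhs : 0 ≤ K * min (∑ t ∈ Finset.Icc 1 T, R t) (Real.sqrt ((1 + C) * T)) :=
    mul_nonneg (by linarith) (le_min hR₀ (Real.sqrt_nonneg _))
  -- On a single point `L`, and with it the rates, need not be positive, but there the gaps and the
  -- regret vanish.
  rcases X.subsingleton_or_nontrivial with hs | hnt
  · constructor
    · intro t ht
      have hx := (hr.strategy t ht).1
      unfold proxGap
      rw [hs (hr.update t ht).1 hx, hφ.coupling_self hx (hr.strategy_subgradient t ht).1]
      simp
    · rw [Finset.sum_eq_zero]
      · linarith
      · intro t ht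
        rw [hs (hr.strategy t ht).1 (hx' t (Finset.mem_Icc.1 ht).2), sub_self]
  have hL : 0 < L := hφ.lipschitz_pos hnt hr.init_mem hr.init_subdiff
  have hA : 0 < L * (Metric.diam X + C) :=
    mul_pos hL (add_pos_of_pos_of_nonneg (Metric.diam_pos hnt hc.isBounded) hC₀)
  have hpos : ∀ t ∈ Finset.Icc 1 T, 0 < η t := fun t ht =>
    hr.rate_pos hφ hX hh hε hA hη ht
  refine ⟨fun t ht => hr.proxGap_nonneg hφ hX ht (hh t ht) (hpos t ht), ?_⟩
  rcases Nat.eq_zero_or_pos T with rfl | hT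
  · simpa using by linarith
  refine (hr.regret_le_sum_proxGap hφ hX hc hf hh hε hL hA hη hx' hC).trans ?_
  rw [add_le_add_iff_left, mul_min_of_nonneg _ _ (by linarith)]
  refine le_min ?_ ?_
  · have h₁ := Finset.sum_le_sum fun t ht =>
      hr.proxGap_le_two_mul hφ ht (hpos t ht) (hR t ht)
    rw [← Finset.mul_sum] at h₁
    linarith [mul_le_mul_of_nonneg_right hK₁ hR₀]
  · have h₁ := hr.sum_proxGap_le_sqrt hφ hX hc (hG hT) hf hh hε hL hC₀ hA hη
    linarith [mul_le_mul_of_nonneg_right hK₂ (Real.sqrt_nonneg ((1 + C) * T))]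

end IsOptimisticProx

end SinglePlayer

/-! ### Reduction of the game to the one-player method. -/

section TwoPlayers

variable {E F : Type*} [NormedAddCommGroup E] [NormedSpace ℝ E]
  [NormedAddCommGroup F] [NormedSpace ℝ F] {X : Set E} {Y : Set F} {GX GY : ℝ}

namespace IsPayoff

variable {H : E → F → ℝ}

/-- The subgradient inequality at `a`, evaluated at `b`, bounds the decrease from `a` to `b` by `GX`
times the distance. -/
theorem isLoss_left (hH : IsPayoff X Y GX GY H) {y : F} (hy : y ∈ Y) :
    IsLoss X GX (fun x => H x y) where
  convex := hH.convex y hy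
  lipschitz a ha b hb := by
    obtain ⟨g, hg, h⟩ := hH.subgrad_left a ha y hy
    have h₁ := h b hb
    have h₂ := g.le_of_opNorm_le hg (b - a)
    rw [Real.norm_eq_abs, norm_sub_rev] at h₂
    linarith [neg_le_of_abs_le h₂]

theorem isLoss_right (hH : IsPayoff X Y GX GY H) {x : E} (hx : x ∈ X) :
    IsLoss Y GY (fun y => -H x y) where
  convex := (hH.concave x hx).neg
  lipschitz a ha b hb := by
    obtain ⟨g, hg, h⟩ := hH.subgrad_right x hx a ha
    have h₁ := h b hb
    have h₂ := g.le_of_opNorm_le hg (b - a)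
    rw [Real.norm_eq_abs, norm_sub_rev] at h₂
    linarith [neg_le_of_abs_le h₂]

theorem nonneg_left (hH : IsPayoff X Y GX GY H) {x : E} (hx : x ∈ X) {y : F} (hy : y ∈ Y) :
    0 ≤ GX := by
  obtain ⟨g, hg, -⟩ := hH.subgrad_left x hx y hy
  exact (norm_nonneg g).trans hg

theorem nonneg_right (hH : IsPayoff X Y GX GY H) {x : E} (hx : x ∈ X) {y : F} (hy : y ∈ Y) :
    0 ≤ GY := by
  obtain ⟨g, hg, -⟩ := hH.subgrad_right x hx y hy
  exact (norm_nonneg g).trans hg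

/-- Guarantees that the supremum defining `rho` is over a bounded set. Moving one variable at a
time, the Lipschitz bounds and the finite diameters suffice. -/
theorem exists_abs_le (hH : IsPayoff X Y GX GY H) (hX : IsCompact X) (hY : IsCompact Y) :
    ∃ M, ∀ x ∈ X, ∀ y ∈ Y, |H x y| ≤ M := by
  rcases X.eq_empty_or_nonempty with rfl | ⟨a, ha⟩
  · exact ⟨0, by simp⟩
  rcases Y.eq_empty_or_nonempty with rfl | ⟨b, hb⟩
  · exact ⟨0, by simp⟩
  refine ⟨|H a b| + GX * Metric.diam X + GY * Metric.diam Y, fun x hx y hy => ?_⟩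
  have hGX := hH.nonneg_left ha hb
  have hGY := hH.nonneg_right ha hb
  have h₁ := (hH.isLoss_left hy).lipschitz x hx a ha
  have h₂ := (hH.isLoss_left hy).lipschitz a ha x hx
  have h₃ := (hH.isLoss_right ha).lipschitz y hy b hb
  have h₄ := (hH.isLoss_right ha).lipschitz b hb y hy
  rw [norm_sub_rev] at h₂ h₄
  have h₅ : GX * ‖x - a‖ ≤ GX * Metric.diam X := by
    rw [← dist_eq_norm]
    exact mul_le_mul_of_nonneg_left (Metric.dist_le_diam_of_mem hX.isBounded hx ha) hGX
  have h₆ : GY * ‖y - b‖ ≤ GY * Metric.diam Y := by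
    rw [← dist_eq_norm]
    exact mul_le_mul_of_nonneg_left (Metric.dist_le_diam_of_mem hY.isBounded hy hb) hGY
  have h₇ := abs_le.1 (le_refl |H a b|)
  exact abs_le.2 ⟨by linarith, by linarith⟩

theorem abs_sub_le_rho {f h : E → F → ℝ} (hf : IsPayoff X Y GX GY f)
    (hh : IsPayoff X Y GX GY h) (hX : IsCompact X) (hY : IsCompact Y) {x : E} (hx : x ∈ X)
    {y : F} (hy : y ∈ Y) : |f x y - h x y| ≤ rho X Y f h := by
  obtain ⟨M, hM⟩ := hf.exists_abs_le hX hY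
  obtain ⟨N, hN⟩ := hh.exists_abs_le hX hY
  refine le_csSup ⟨M + N, ?_⟩ (Set.mem_image2_of_mem hx hy)
  rintro _ ⟨u, hu, v, hv, rfl⟩
  exact (abs_sub _ _).trans (add_le_add (hM u hu v hv) (hN u hu v hv))

end IsPayoff

namespace Trajectory

variable {r : Trajectory E F} {φ : E → EReal} {ψ : F → EReal} {f h : ℕ → E → F → ℝ} {T : ℕ}

/-- At `y = y_t` the `ψ` term is constant in `x` and drops out of the saddle inequality. -/
theorem IsOptOPPM.first_player (hr : r.IsOptOPPM X Y φ ψ f h T) :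
    IsOptimisticProx X φ (fun t u => f t u (r.y t)) (fun t u => h t u (r.y t)) T
      r.x r.xt r.xd r.xtd r.η where
  init_mem := hr.init_x
  init_subdiff := hr.init_xd
  strategy t ht := ⟨(hr.strategy t ht).1, fun u hu => by
    have := (hr.strategy t ht).2.2.2 u hu
    simp only [Set.mem_ofPred_eq] at this ⊢
    linarith⟩
  strategy_subgradient := hr.strategy_xd
  update := hr.update_x
  update_subgradient := hr.update_xd

theorem IsOptOPPM.second_player (hr : r.IsOptOPPM X Y φ ψ f h T) :
    IsOptimisticProx Y ψ (fun t v => -f t (r.x t) v) (fun t v => -h t (r.x t) v) T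
      r.y r.yt r.yd r.ytd r.γ where
  init_mem := hr.init_y
  init_subdiff := hr.init_yd
  strategy t ht := ⟨(hr.strategy t ht).2.1, fun v hv => by
    have := (hr.strategy t ht).2.2.1 v hv
    simp only [Set.mem_ofPred_eq] at this ⊢
    linarith⟩
  strategy_subgradient t ht := by simpa only [mul_neg] using hr.strategy_yd t ht
  update t ht := ⟨(hr.update_y t ht).1, fun v hv => by
    have := (hr.update_y t ht).2 hv
    simp only [Set.mem_ofPred_eq] at this ⊢
    linarith⟩
  update_subgradient t ht := by simpa only [mul_neg] using hr.update_yd t ht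

theorem δ₁_eq_proxGap (t : ℕ) : r.δ₁ φ f h t =
    proxGap φ (fun t u => f t u (r.y t)) (fun t u => h t u (r.y t)) r.x r.xt r.xd r.η t := rfl

theorem δ₂_eq_proxGap (t : ℕ) : r.δ₂ ψ f h t =
    proxGap ψ (fun t v => -f t (r.x t) v) (fun t v => -h t (r.x t) v)
      r.y r.yt r.yd r.γ t := by
  unfold δ₂ proxGap
  ring

end Trajectory

end TwoPlayers

end OSP

theorem mainTheorem5 (DX DY GX GY Lφ Lψ : ℝ) :
    ∃ K : ℝ, 0 < K ∧
      ∀ (E F : Type*) [NormedAddCommGroup E] [NormedSpace ℝ E]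
        [NormedAddCommGroup F] [NormedSpace ℝ F]
        (X : Set E) (Y : Set F) (φ : E → EReal) (ψ : F → EReal)
        (f h : ℕ → E → F → ℝ) (T : ℕ) (C₁ C₂ ε : ℝ)
        (r : OSP.Trajectory E F) (x' : ℕ → E) (y' : ℕ → F),
        IsCompact X → Convex ℝ X → Metric.diam X = DX →
        IsCompact Y → Convex ℝ Y → Metric.diam Y = DY →
        (∀ t ∈ Finset.Icc 1 T, OSP.IsPayoff X Y GX GY (f t)) →
        (∀ t ∈ Finset.Icc 1 T, OSP.IsPayoff X Y GX GY (h t)) →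
        OSP.IsRegularizer X φ Lφ →
        OSP.IsRegularizer Y ψ Lψ →
        0 < ε →
        r.IsOptOPPM X Y φ ψ f h T →
        r.HasAdaptiveRates X Y φ ψ Lφ Lψ C₁ C₂ ε f h T →
        x' 0 ∈ X →
        (∀ t ∈ Finset.Icc 1 T, OSP.IsArgMin X (fun x => f t x (r.y t)) (x' t)) →
        y' 0 ∈ Y →
        (∀ t ∈ Finset.Icc 1 T, OSP.IsArgMax Y (fun y => f t (r.x t) y) (y' t)) →
        OSP.pathLength x' T ≤ C₁ →
        OSP.pathLength y' T ≤ C₂ →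
        (∀ t ∈ Finset.Icc 1 T, 0 ≤ r.δ₁ φ f h t ∧ 0 ≤ r.δ₂ ψ f h t) ∧
        r.reg₁ f x' T ≤ ε + K * min (∑ t ∈ Finset.Icc 1 T, OSP.rho X Y (f t) (h t))
          (Real.sqrt ((1 + C₁) * T)) ∧
        r.reg₂ f y' T ≤ ε + K * min (∑ t ∈ Finset.Icc 1 T, OSP.rho X Y (f t) (h t))
          (Real.sqrt ((1 + C₂) * T)) := by
  -- The regret is at most `ε + 2 ∑ δ_t`: the `4` comes from `δ_t ≤ 2ρ`, the other two from the
  -- square-root bound for each player.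
  obtain ⟨K, hK, hKX, hKY⟩ : ∃ K, 4 ≤ K ∧
      2 * Real.sqrt (4 * GX ^ 2 * DX ^ 2 + 4 * GX ^ 2 * Lφ * (DX + 1)) ≤ K ∧
      2 * Real.sqrt (4 * GY ^ 2 * DY ^ 2 + 4 * GY ^ 2 * Lψ * (DY + 1)) ≤ K :=
    ⟨max 4 (max _ _), le_max_left _ _, (le_max_left _ _).trans (le_max_right _ _),
      (le_max_right _ _).trans (le_max_right _ _)⟩
  refine ⟨K, by linarith, ?_⟩
  intro E F _ _ _ _ X Y φ ψ f h T C₁ C₂ ε r x' y' hXc hX hDX hYc hY hDY hf hh hφ hψ hε hr hrate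
    hx₀ hx' hy₀ hy' hC₁ hC₂
  subst hDX hDY
  have hxm : ∀ t ∈ Finset.Icc 1 T, r.x t ∈ X := fun t ht => (hr.strategy t ht).1
  have hym : ∀ t ∈ Finset.Icc 1 T, r.y t ∈ Y := fun t ht => (hr.strategy t ht).2.1
  have hρ : ∀ t ∈ Finset.Icc 1 T, ∀ u ∈ X, ∀ v ∈ Y,
      |f t u v - h t u v| ≤ OSP.rho X Y (f t) (h t) := fun t ht u hu v hv =>
    (hf t ht).abs_sub_le_rho (hh t ht) hXc hYc hu hv
  obtain ⟨hδ₁, hreg₁⟩ := hr.first_player.regret_le hφ hX hXc (G := GX)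
    (fun hT => (hf 1 (Finset.mem_Icc.2 ⟨le_rfl, hT⟩)).nonneg_left hr.init_x hr.init_y)
    (fun t ht => (hf t ht).isLoss_left (hym t ht))
    (fun t ht => (hh t ht).isLoss_left (hym t ht)) hε hrate.rate_x
    (x' := x') (fun t ht => by
      rcases Nat.eq_zero_or_pos t with rfl | h0
      · exact hx₀
      · exact (hx' t (Finset.mem_Icc.2 ⟨h0, ht⟩)).1)
    hC₁ (fun t ht u hu => hρ t ht u hu _ (hym t ht)) hK hKX
  obtain ⟨hδ₂, hreg₂⟩ := hr.second_player.regret_le hψ hY hYc (G := GY)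
    (fun hT => (hf 1 (Finset.mem_Icc.2 ⟨le_rfl, hT⟩)).nonneg_right hr.init_x hr.init_y)
    (fun t ht => (hf t ht).isLoss_right (hxm t ht))
    (fun t ht => (hh t ht).isLoss_right (hxm t ht)) hε
    (by simpa only [OSP.Trajectory.δ₂_eq_proxGap] using hrate.rate_y)
    (x' := y') (fun t ht => by
      rcases Nat.eq_zero_or_pos t with rfl | h0
      · exact hy₀
      · exact (hy' t (Finset.mem_Icc.2 ⟨h0, ht⟩)).1)
    hC₂ (R := fun t => OSP.rho X Y (f t) (h t))
    (fun t ht v hv => by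
      have := hρ t ht _ (hxm t ht) v hv
      rwa [neg_sub_neg, abs_sub_comm])
    hK hKY
  refine ⟨fun t ht => ⟨hδ₁ t ht, ?_⟩, ?_, ?_⟩
  · rw [OSP.Trajectory.δ₂_eq_proxGap]
    exact hδ₂ t ht
  · rw [OSP.Trajectory.reg₁, ← Finset.sum_sub_distrib]
    exact hreg₁
  · rw [OSP.Trajectory.reg₂, ← Finset.sum_sub_distrib]
    simpa only [neg_sub_neg] using hreg₂
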